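/- There are absolute constants $c,C\in(0,\infty)$ such that the following holds. Let $n,N\in\mathbb N$ with $N\ge n$ and let $X_1,\dots,X_N$ be independent and identically distributed random vectors in $\mathbb R^n$. For $1\le \ell\le m\le N$ and $\theta$ in the Euclidean unit sphere $\mathbb S^{n-1}$ put \[ h_{K_{m,\ell,1}}(\theta)=\frac1\ell\sum_{k=1}^{\ell}\;k\text{-}\max_{1\le i\le m}|\langle X_i,\theta\rangle| , \] where $k\text{-}\max_{1\le i\le m}a_i$ is the $k$-th largest of the numbers $a_1,\dots,a_m$, counted with multiplicity. This is the support function in direction $\theta$ of a random convex body $K_{m,\ell,1}$; in particular $h_{K_{m,1,1}}(\theta)=\max_{1\le i\le m}|\langle X_i,\theta\rangle|$, the support function of $\operatorname{conv}\{\pm X_1,\dots,\pm X_m\}$. Then, for all $1\le\ell\le N$ and all $\theta\in\mathbb S^{n-1}$, \[ c\,\mathbb E\,h_{K_{\lfloor N/\ell\rfloor,1,1}}(\theta)\;\le\;\mathbb E\,h_{K_{N,\ell,1}}(\theta)\;\le\; C\,\mathbb E\,h_{K_{\lceil N/\ell\rceil,1,1}}(\theta), \] where the expectations of these nonnegative random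 variables are taken in $[0,\infty]$. -/

import Mathlib

open MeasureTheory ProbabilityTheory

noncomputable section

/-- The `k`-th largest of the numbers `a 0, …, a (N - 1)`, counted with multiplicity, for
`1 ≤ k ≤ N` (so `k = 1` gives the maximum and `k = N` the minimum). `a ∘ Tuple.sort a` is the
nondecreasing rearrangement of `a`, whose entry at the position `N - k` (counted from `0`) is the
`k`-th largest. The value for other `k` is `0` and is never used. -/
def kMax {N : ℕ} (k : ℕ) (a : Fin N → ℝ) : ℝ :=
  if hk : 1 ≤ k ∧ k ≤ N then (a ∘ Tuple.sort a) ⟨N - k, by omega⟩ else 0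

/-- The support function `h_{K_{N,ℓ,q}}` of the convex body generated by the points
`x 0, …, x (N - 1)` of `ℝⁿ`:
`h_{K_{N,ℓ,q}}(θ) = ((1/ℓ) ∑_{k=1}^ℓ k-max_i |⟨x i, θ⟩|^q)^{1/q}`. -/
def supportK {n N : ℕ} (ℓ : ℕ) (q : ℝ) (x : Fin N → EuclideanSpace ℝ (Fin n))
    (θ : EuclideanSpace ℝ (Fin n)) : ℝ :=
  ((1 / (ℓ : ℝ)) * ∑ k ∈ Finset.Icc 1 ℓ, kMax k (fun i => |inner ℝ (x i) θ| ^ q)) ^ (1 / q)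

/-- The first `m` members of a family of `N` objects. -/
def firstOf {α : Type*} {N m : ℕ} (hm : m ≤ N) (X : Fin N → α) : Fin m → α :=
  fun i => X (Fin.castLE hm i)

theorem floor_div_le (N ℓ : ℕ) : ⌊(N : ℝ) / (ℓ : ℝ)⌋₊ ≤ N := by
  rw [Nat.floor_div_eq_div]
  exact Nat.div_le_self N ℓ

theorem ceil_div_le (N ℓ : ℕ) : ⌈(N : ℝ) / (ℓ : ℝ)⌉₊ ≤ N := by
  refine Nat.ceil_le.2 ?_
  rcases Nat.eq_zero_or_pos ℓ with rfl | h
  · simp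
  · exact div_le_self (Nat.cast_nonneg N) (by exact_mod_cast h)

end

/-!
Everything reduces to one direction `θ`, that is, to independent identically distributed
nonnegative random variables `Y i = |⟨X i, θ⟩|`. Write `Z t` for the number of indices with
`t < Y i`. The `k`-th largest value exceeds `t` exactly when `k ≤ Z t` (`lt_kMax_iff`), so by the
layer cake formula the expected sum of the `ℓ` largest values is
`∫₀^∞ ∑_{k ≤ ℓ} P (k ≤ Z t) dt = ∫₀^∞ E [min (ℓ, Z t)] dt`, whereas the expected maximum of the first
`m` values is `∫₀^∞ (1 - (1 - p) ^ m) dt` with `p = P (t < Y i)`. It remains to compare the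
integrands for fixed `t`.

* Lower bound, with `c = 1` (`mul_measure_exists_le_sum`): for `m = ⌊N / ℓ⌋` there are `ℓ` disjoint
  blocks of `m` indices, and the number of blocks containing an index with `t < Y i` is at most
  `min (ℓ, Z t)`. Each block contains one with probability `1 - (1 - p) ^ m`.
* Upper bound, with `C = 2` (`sum_measure_le_two_mul`): for `m = ⌈N / ℓ⌉`, one has
  `E [min (ℓ, Z t)] ≤ min (ℓ, N p) ≤ ℓ min (1, m p)`, and Bernoulli's inequality gives
  `1 - (1 - p) ^ m ≥ m p / (1 + m p) ≥ min (1, m p) / 2`.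
-/

open Finset in
/-- The `k`-th largest entry exceeds `t` exactly when at least `k` entries do. -/
theorem lt_kMax_iff {N k : ℕ} (hk : 1 ≤ k) (hkN : k ≤ N) (a : Fin N → ℝ) (t : ℝ) :
    t < kMax k a ↔ k ≤ #{i | t < a i} := by
  have hmono : Monotone (a ∘ Tuple.sort a) := Tuple.monotone_sort a
  have hcard : #{i | t < a i} = #{i | t < (a ∘ Tuple.sort a) i} := by
    refine (Finset.card_bij (fun i _ => Tuple.sort a i) ?_ ?_ ?_).symm
    · intro i hi; simpa using hi
    · intro i _ j _ h; exact (Tuple.sort a).injective h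
    · intro j hj; exact ⟨(Tuple.sort a).symm j, by simpa using hj, by simp⟩
  rw [hcard, kMax, dif_pos ⟨hk, hkN⟩]
  generalize a ∘ Tuple.sort a = b at hmono
  constructor
  · intro h
    have hsub : Finset.Ici (⟨N - k, by omega⟩ : Fin N) ⊆ ({i | t < b i} : Finset (Fin N)) := by
      intro j hj
      simpa using h.trans_le (hmono (Finset.mem_Ici.1 hj))
    have h2 := Finset.card_le_card hsub
    rw [Fin.card_Ici] at h2
    simp only at h2
    omega
  · intro h
    by_contra! hle
    have hsub : ({i | t < b i} : Finset (Fin N)) ⊆ Finset.Ioi (⟨N - k, by omega⟩ : Fin N) := by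
      intro j hj
      rw [Finset.mem_Ioi]
      by_contra! hj'
      exact absurd ((Finset.mem_filter.1 hj).2.trans_le (hmono hj')) (not_lt.2 hle)
    have h2 := Finset.card_le_card hsub
    rw [Fin.card_Ioi] at h2
    simp only at h2
    omega

theorem kMax_nonneg {N : ℕ} (k : ℕ) {a : Fin N → ℝ} (ha : ∀ i, 0 ≤ a i) : 0 ≤ kMax k a := by
  unfold kMax
  split_ifs
  · exact ha _
  · exact le_rfl

theorem ofReal_supportK_one {n N : ℕ} {ℓ : ℕ} (hℓ : 1 ≤ ℓ) (x : Fin N → EuclideanSpace ℝ (Fin n))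
    (θ : EuclideanSpace ℝ (Fin n)) :
    ENNReal.ofReal (supportK ℓ 1 x θ) =
      (ℓ : ENNReal)⁻¹ * ∑ k ∈ Finset.Icc 1 ℓ, ENNReal.ofReal (kMax k fun i => |inner ℝ (x i) θ|) := by
  have hpos : (0 : ℝ) < ℓ := by exact_mod_cast hℓ
  simp only [supportK, Real.rpow_one, div_one, one_div]
  rw [ENNReal.ofReal_mul (by positivity), ENNReal.ofReal_inv_of_pos hpos, ENNReal.ofReal_natCast,
    ENNReal.ofReal_sum_of_nonneg fun k _ => kMax_nonneg k fun i => abs_nonneg _]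

section

variable {Ω : Type*} [MeasurableSpace Ω] {P : Measure Ω} {N : ℕ} {Y : Fin N → Ω → ℝ}

open Finset in
theorem measurable_card_lt (hY : ∀ i, Measurable (Y i)) (t : ℝ) :
    Measurable fun ω => #{i | t < Y i ω} := by
  simp_rw [Finset.card_filter]
  exact Finset.measurable_sum _ fun i _ =>
    Measurable.ite (measurableSet_lt measurable_const (hY i)) measurable_const measurable_const

theorem measurable_kMax (hY : ∀ i, Measurable (Y i)) {k : ℕ} (hk : 1 ≤ k) (hkN : k ≤ N) :
    Measurable fun ω => kMax k fun i => Y i ω := by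
  refine measurable_of_Ioi fun t => ?_
  simp_rw [Set.preimage, Set.mem_Ioi, lt_kMax_iff hk hkN]
  exact measurableSet_le measurable_const (measurable_card_lt hY t)

open Finset in
/-- The layer cake formula for the `k`-th largest of finitely many random variables. -/
theorem lintegral_kMax (hY : ∀ i, Measurable (Y i)) (hY0 : ∀ i ω, 0 ≤ Y i ω) {k : ℕ}
    (hk : 1 ≤ k) (hkN : k ≤ N) :
    ∫⁻ ω, ENNReal.ofReal (kMax k fun i => Y i ω) ∂P =
      ∫⁻ t in Set.Ioi (0 : ℝ), P {ω | k ≤ #{i | t < Y i ω}} := by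
  rw [lintegral_eq_lintegral_meas_lt P
    (Filter.Eventually.of_forall fun ω => kMax_nonneg k fun i => hY0 i ω)
    (measurable_kMax hY hk hkN).aemeasurable]
  simp_rw [lt_kMax_iff hk hkN]

open Finset in
/-- The layer cake formula for the sum of the `ℓ` largest of finitely many random variables. -/
theorem lintegral_sum_kMax (hY : ∀ i, Measurable (Y i)) (hY0 : ∀ i ω, 0 ≤ Y i ω) {ℓ : ℕ}
    (hℓN : ℓ ≤ N) :
    ∫⁻ ω, ∑ k ∈ Finset.Icc 1 ℓ, ENNReal.ofReal (kMax k fun i => Y i ω) ∂P =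
      ∫⁻ t in Set.Ioi (0 : ℝ), ∑ k ∈ Finset.Icc 1 ℓ, P {ω | k ≤ #{i | t < Y i ω}} := by
  have hmeas : ∀ k ∈ Finset.Icc 1 ℓ, Measurable fun ω => ENNReal.ofReal (kMax k fun i => Y i ω) := by
    intro k hk
    rw [Finset.mem_Icc] at hk
    exact (measurable_kMax hY hk.1 (hk.2.trans hℓN)).ennreal_ofReal
  rw [lintegral_finsetSum _ hmeas, lintegral_finsetSum]
  · refine Finset.sum_congr rfl fun k hk => ?_
    rw [Finset.mem_Icc] at hk
    exact lintegral_kMax hY hY0 hk.1 (hk.2.trans hℓN)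
  · intro k _
    refine Antitone.measurable fun s t hst => measure_mono fun ω hω => ?_
    exact le_trans (b := #{i | t < Y i ω}) hω (Finset.card_le_card fun i hi => by
      simp only [Finset.mem_filter, Finset.mem_univ, true_and] at hi ⊢
      exact hst.trans_lt hi)

open Finset in
theorem sum_measure_le_eq_lintegral_min (hY : ∀ i, Measurable (Y i)) (ℓ : ℕ) (t : ℝ) :
    ∑ k ∈ Finset.Icc 1 ℓ, P {ω | k ≤ #{i | t < Y i ω}} =
      ∫⁻ ω, (min ℓ #{i | t < Y i ω} : ℕ) ∂P := by
  have hms : ∀ k, MeasurableSet {ω | k ≤ #{i | t < Y i ω}} := fun k =>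
    measurableSet_le measurable_const (measurable_card_lt hY t)
  simp_rw [← fun k => lintegral_indicator_one (μ := P) (hms k)]
  rw [← lintegral_finsetSum _ fun k _ => measurable_one.indicator (hms k)]
  refine lintegral_congr fun ω => ?_
  simp only [Set.indicator_apply, Set.mem_ofPred_eq, Pi.one_apply]
  rw [← Finset.sum_filter, Finset.sum_const, nsmul_eq_mul, mul_one]
  have : {k ∈ Finset.Icc 1 ℓ | k ≤ #{i | t < Y i ω}} =
      Finset.Icc 1 (min ℓ #{i | t < Y i ω}) := by
    ext k
    simp only [Finset.mem_filter, Finset.mem_Icc, le_min_iff, and_assoc]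
  rw [this, Nat.card_Icc, Nat.add_sub_cancel]

/-- The probability that one of the independent identically distributed variables with index in
`S` exceeds `t`. -/
theorem measure_exists_lt [IsProbabilityMeasure P] (hY : ∀ i, Measurable (Y i))
    (hind : iIndepFun Y P) {p t : ℝ} (hp : ∀ i, P.real {ω | t < Y i ω} = p)
    (S : Finset (Fin N)) :
    P {ω | ∃ i ∈ S, t < Y i ω} = ENNReal.ofReal (1 - (1 - p) ^ S.card) := by
  have hms : ∀ i, MeasurableSet {ω | t < Y i ω} := fun i => measurableSet_lt measurable_const (hY i)
  have hcompl : {ω | ∃ i ∈ S, t < Y i ω} = (⋂ i ∈ S, Y i ⁻¹' Set.Iic t)ᶜ := by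
    ext ω; simp
  have hmi : MeasurableSet (⋂ i ∈ S, Y i ⁻¹' Set.Iic t) :=
    Finset.measurableSet_biInter _ fun i _ => hY i measurableSet_Iic
  rw [← ofReal_measureReal (measure_ne_top _ _), hcompl, probReal_compl_eq_one_sub hmi]
  congr 2
  rw [measureReal_def, hind.measure_inter_preimage_eq_mul S fun i _ => measurableSet_Iic,
    ENNReal.toReal_prod]
  refine Finset.prod_eq_pow_card fun i _ => ?_
  have : Y i ⁻¹' Set.Iic t = {ω | t < Y i ω}ᶜ := by ext ω; simp
  rw [← measureReal_def, this, probReal_compl_eq_one_sub (hms i), hp i]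

open Finset in
/-- Among `ℓ` disjoint blocks of `m` indices, the number of those meeting `{i | t < Y i}` is at most
`min ℓ #{i | t < Y i}`. -/
theorem mul_measure_exists_le_sum [IsProbabilityMeasure P] (hY : ∀ i, Measurable (Y i))
    (hind : iIndepFun Y P) {p t : ℝ} (hp : ∀ i, P.real {ω | t < Y i ω} = p)
    {ℓ m : ℕ} (hm : 1 ≤ m) (hmN : ℓ * m ≤ N) :
    ℓ * ENNReal.ofReal (1 - (1 - p) ^ m) ≤
      ∑ k ∈ Finset.Icc 1 ℓ, P {ω | k ≤ #{i | t < Y i ω}} := by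
  classical
  rw [sum_measure_le_eq_lintegral_min hY]
  -- The blocks are the fibres of `i ↦ i / m` over `0, …, ℓ - 1`.
  have hblock : ∀ b ∈ Finset.range ℓ, #{i : Fin N | (i : ℕ) / m = b} = m := by
    intro b hb
    rw [Finset.mem_range] at hb
    have hbm : (b + 1) * m ≤ N := (Nat.mul_le_mul_right m hb).trans hmN
    rw [← Finset.card_map Fin.valEmbedding]
    have : ({i : Fin N | (i : ℕ) / m = b} : Finset (Fin N)).map Fin.valEmbedding =
        Finset.Ico (b * m) ((b + 1) * m) := by
      ext j
      simp only [Finset.mem_map, Finset.mem_filter, Finset.mem_univ, true_and,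
        Fin.valEmbedding_apply, Finset.mem_Ico]
      have hdiv : (b * m ≤ j ∧ j < (b + 1) * m) ↔ j / m = b := by
        rw [← Nat.le_div_iff_mul_le hm, ← Nat.div_lt_iff_lt_mul hm]
        omega
      rw [hdiv]
      constructor
      · rintro ⟨i, hi, rfl⟩; exact hi
      · intro h
        refine ⟨⟨j, lt_of_lt_of_le ?_ hbm⟩, h, rfl⟩
        exact (Nat.div_lt_iff_lt_mul hm).1 (by omega)
    rw [this, Nat.card_Ico, Nat.succ_mul, Nat.add_sub_cancel_left]
  have hms : ∀ b, MeasurableSet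
      {ω | ∃ i ∈ ({i : Fin N | (i : ℕ) / m = b} : Finset (Fin N)), t < Y i ω} := by
    intro b
    have : {ω | ∃ i ∈ ({i : Fin N | (i : ℕ) / m = b} : Finset (Fin N)), t < Y i ω} =
        ⋃ i ∈ ({i : Fin N | (i : ℕ) / m = b} : Finset (Fin N)), {ω | t < Y i ω} := by
      ext ω; simp
    rw [this]
    exact Finset.measurableSet_biUnion _ fun i _ => measurableSet_lt measurable_const (hY i)
  calc ℓ * ENNReal.ofReal (1 - (1 - p) ^ m)
      = ∑ b ∈ Finset.range ℓ,
          P {ω | ∃ i ∈ ({i : Fin N | (i : ℕ) / m = b} : Finset (Fin N)), t < Y i ω} := by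
        rw [Finset.sum_congr rfl fun b hb => by rw [measure_exists_lt hY hind hp, hblock b hb]]
        simp
    _ = ∫⁻ ω, ∑ b ∈ Finset.range ℓ,
          {ω | ∃ i ∈ ({i : Fin N | (i : ℕ) / m = b} : Finset (Fin N)), t < Y i ω}.indicator
            1 ω ∂P := by
        rw [lintegral_finsetSum _ fun b _ => measurable_one.indicator (hms b)]
        simp_rw [lintegral_indicator_one (hms _)]
    _ ≤ ∫⁻ ω, (min ℓ #{i | t < Y i ω} : ℕ) ∂P := by
        refine lintegral_mono fun ω => ?_
        simp only [Set.indicator_apply, Set.mem_ofPred_eq, Pi.one_apply]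
        rw [← Finset.sum_filter, Finset.sum_const, nsmul_eq_mul, mul_one]
        refine Nat.cast_le.2 (le_min ((Finset.card_filter_le _ _).trans (by simp)) ?_)
        refine (Finset.card_le_card (t := Finset.image (fun i : Fin N => (i : ℕ) / m)
          {i | t < Y i ω}) ?_).trans Finset.card_image_le
        intro b hb
        simp only [Finset.mem_filter, Finset.mem_univ, true_and] at hb
        obtain ⟨-, i, hi, hti⟩ := hb
        exact Finset.mem_image.2 ⟨i, by simpa using hti, hi⟩

/-- A consequence of `(1 - p) ^ m * (1 + m * p) ≤ (1 - p) ^ m * (1 + p) ^ m ≤ 1`. -/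
theorem min_one_mul_le_two_mul_one_sub_pow {p : ℝ} (hp0 : 0 ≤ p) (hp1 : p ≤ 1) (m : ℕ) :
    min 1 (m * p) ≤ 2 * (1 - (1 - p) ^ m) := by
  have hbern : 1 + m * p ≤ (1 + p) ^ m := one_add_mul_le_pow (by linarith) m
  have hq0 : 0 ≤ (1 - p) ^ m := pow_nonneg (by linarith) m
  have hprod : (1 - p) ^ m * (1 + m * p) ≤ 1 := by
    refine (mul_le_mul_of_nonneg_left hbern hq0).trans ?_
    rw [← mul_pow]
    exact pow_le_one₀ (by nlinarith) (by nlinarith)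
  have hx : 0 ≤ m * p := by positivity
  generalize (m : ℝ) * p = x at *
  generalize (1 - p) ^ m = q at *
  rcases le_total x 1 with h | h
  · rw [min_eq_right h]; nlinarith
  · rw [min_eq_left h]; nlinarith

open Finset in
/-- The left side is the expectation of `min ℓ Z` with `Z = #{i | t < Y i}`, hence at most
`min ℓ (N * p)`. -/
theorem sum_measure_le_two_mul [IsProbabilityMeasure P] (hY : ∀ i, Measurable (Y i))
    {p t : ℝ} (hp : ∀ i, P.real {ω | t < Y i ω} = p) (hp0 : 0 ≤ p) (hp1 : p ≤ 1)
    {ℓ m : ℕ} (hmN : N ≤ ℓ * m) :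
    ∑ k ∈ Finset.Icc 1 ℓ, P {ω | k ≤ #{i | t < Y i ω}} ≤
      2 * (ℓ * ENNReal.ofReal (1 - (1 - p) ^ m)) := by
  have hms : ∀ i, MeasurableSet {ω | t < Y i ω} := fun i => measurableSet_lt measurable_const (hY i)
  rw [sum_measure_le_eq_lintegral_min hY]
  have hleft : ∫⁻ ω, (min ℓ #{i | t < Y i ω} : ℕ) ∂P ≤ ENNReal.ofReal ℓ := by
    refine (lintegral_mono fun ω => Nat.cast_le.2 (min_le_left _ _)).trans ?_
    simp
  have hright : ∫⁻ ω, (min ℓ #{i | t < Y i ω} : ℕ) ∂P ≤ ENNReal.ofReal (N * p) := by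
    calc ∫⁻ ω, (min ℓ #{i | t < Y i ω} : ℕ) ∂P
        ≤ ∫⁻ ω, ∑ i, {ω | t < Y i ω}.indicator 1 ω ∂P := by
          refine lintegral_mono fun ω => (Nat.cast_le.2 (min_le_right _ _)).trans ?_
          simp only [Set.indicator_apply, Set.mem_ofPred_eq, Pi.one_apply]
          rw [← Finset.sum_filter, Finset.sum_const, nsmul_eq_mul, mul_one]
      _ = ∑ i, P {ω | t < Y i ω} := by
          rw [lintegral_finsetSum _ fun i _ => measurable_one.indicator (hms i)]
          simp_rw [lintegral_indicator_one (hms _)]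
      _ = ENNReal.ofReal (N * p) := by
          simp_rw [← fun i => ofReal_measureReal (measure_ne_top P {ω | t < Y i ω}), hp]
          rw [ENNReal.ofReal_mul (Nat.cast_nonneg N)]
          simp
  have hmin := le_min hleft hright
  rw [← ENNReal.ofReal_min] at hmin
  refine hmin.trans ?_
  rw [← ENNReal.ofReal_natCast ℓ, ← ENNReal.ofReal_mul (Nat.cast_nonneg ℓ),
    ← ENNReal.ofReal_ofNat, ← ENNReal.ofReal_mul zero_le_two]
  refine ENNReal.ofReal_le_ofReal ?_
  have hkey := mul_le_mul_of_nonneg_left (min_one_mul_le_two_mul_one_sub_pow hp0 hp1 m)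
    (Nat.cast_nonneg (α := ℝ) ℓ)
  have hcast : (N : ℝ) ≤ ℓ * m := by exact_mod_cast hmN
  rw [mul_min_of_nonneg _ _ (Nat.cast_nonneg ℓ), mul_one] at hkey
  refine (min_le_min_left _ ?_).trans (hkey.trans_eq (by ring))
  rw [← mul_assoc]
  exact mul_le_mul_of_nonneg_right hcast hp0

end

open Finset in
/-- The layer cake formula for the maximum of the first `m` values. -/
theorem lintegral_supportK_firstOf {Ω : Type*} [MeasurableSpace Ω] {P : Measure Ω}
    [IsProbabilityMeasure P] {n N : ℕ} {X : Fin N → Ω → EuclideanSpace ℝ (Fin n)}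
    {θ : EuclideanSpace ℝ (Fin n)} (hY : ∀ i, Measurable fun ω => |inner ℝ (X i ω) θ|)
    (hind : iIndepFun (fun i ω => |inner ℝ (X i ω) θ|) P) {p : ℝ → ℝ}
    (hp : ∀ t i, P.real {ω | t < |inner ℝ (X i ω) θ|} = p t) {m : ℕ} (hm : 1 ≤ m) (hmN : m ≤ N) :
    ∫⁻ ω, ENNReal.ofReal (supportK 1 1 (fun i => firstOf hmN X i ω) θ) ∂P =
      ∫⁻ t in Set.Ioi (0 : ℝ), ENNReal.ofReal (1 - (1 - p t) ^ m) := by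
  simp_rw [ofReal_supportK_one le_rfl, Nat.cast_one, inv_one, one_mul]
  rw [lintegral_sum_kMax (Y := fun i ω => |inner ℝ (firstOf hmN X i ω) θ|)
    (fun i => hY _) (fun i ω => abs_nonneg _) hm]
  refine lintegral_congr fun t => ?_
  have h := measure_exists_lt hY hind (hp t) (Finset.univ.map (Fin.castLEEmb hmN))
  rw [Finset.card_map, Finset.card_univ, Fintype.card_fin] at h
  rw [← h, Finset.Icc_self, Finset.sum_singleton]
  congr 1
  ext ω
  rw [Set.mem_ofPred_eq, Finset.one_le_card, Finset.filter_nonempty_iff]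
  simp [firstOf]

theorem mainTheorem4 :
    ∃ c C : ℝ, 0 < c ∧ 0 < C ∧
      ∀ (Ω : Type*) [MeasurableSpace Ω] (P : Measure Ω) [IsProbabilityMeasure P]
        (n N : ℕ), n ≤ N →
        ∀ X : Fin N → Ω → EuclideanSpace ℝ (Fin n),
          (∀ i, Measurable (X i)) →
          iIndepFun X P →
          (∀ i j, IdentDistrib (X i) (X j) P P) →
          ∀ ℓ : ℕ, 1 ≤ ℓ → ℓ ≤ N →
            ∀ θ ∈ Metric.sphere (0 : EuclideanSpace ℝ (Fin n)) 1,
              ENNReal.ofReal c *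
                  ∫⁻ ω, ENNReal.ofReal
                    (supportK 1 1 (fun i => firstOf (floor_div_le N ℓ) X i ω) θ) ∂P
                ≤ ∫⁻ ω, ENNReal.ofReal (supportK ℓ 1 (fun i => X i ω) θ) ∂P ∧
              ∫⁻ ω, ENNReal.ofReal (supportK ℓ 1 (fun i => X i ω) θ) ∂P
                ≤ ENNReal.ofReal C *
                  ∫⁻ ω, ENNReal.ofReal
                    (supportK 1 1 (fun i => firstOf (ceil_div_le N ℓ) X i ω) θ) ∂P := by
  refine ⟨1, 2, one_pos, two_pos, ?_⟩
  intro Ω _ P _ n N _ X hX hind hid ℓ hℓ hℓN θ _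
  have hg : Measurable fun x : EuclideanSpace ℝ (Fin n) => |inner ℝ x θ| := by fun_prop
  have hY : ∀ i, Measurable fun ω => |inner ℝ (X i ω) θ| := fun i => hg.comp (hX i)
  have hindY : iIndepFun (fun i ω => |inner ℝ (X i ω) θ|) P := hind.comp _ fun _ => hg
  have hNpos : 0 < N := by omega
  have hℓpos : (0 : ℝ) < ℓ := by exact_mod_cast hℓ
  set p : ℝ → ℝ := fun t => P.real {ω | t < |inner ℝ (X ⟨0, hNpos⟩ ω) θ|} with hpdef
  have hp : ∀ t i, P.real {ω | t < |inner ℝ (X i ω) θ|} = p t := by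
    intro t i
    exact congrArg ENNReal.toReal
      (((hid i ⟨0, hNpos⟩).comp hg).measure_mem_eq (measurableSet_Ioi (a := t)))
  have hfloor : 1 ≤ ⌊(N : ℝ) / ℓ⌋₊ := by
    rw [Nat.floor_div_eq_div]
    exact (Nat.one_le_div_iff hℓ).2 hℓN
  have hfloorN : ℓ * ⌊(N : ℝ) / ℓ⌋₊ ≤ N := by
    rw [Nat.floor_div_eq_div]
    exact Nat.mul_div_le N ℓ
  have hceil : 1 ≤ ⌈(N : ℝ) / ℓ⌉₊ := Nat.one_le_ceil_iff.2 (by positivity)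
  have hceilN : N ≤ ℓ * ⌈(N : ℝ) / ℓ⌉₊ := by
    have h := (div_le_iff₀' hℓpos).1 (Nat.le_ceil ((N : ℝ) / ℓ))
    exact_mod_cast h
  have hinv : (ℓ : ENNReal)⁻¹ * ℓ = 1 :=
    ENNReal.inv_mul_cancel (by exact_mod_cast (by omega : ℓ ≠ 0)) (ENNReal.natCast_ne_top ℓ)
  have hinv_ne : (ℓ : ENNReal)⁻¹ ≠ ⊤ := ENNReal.inv_ne_top.2 (by exact_mod_cast (by omega : ℓ ≠ 0))
  rw [lintegral_supportK_firstOf hY hindY hp hfloor, lintegral_supportK_firstOf hY hindY hp hceil]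
  simp_rw [ofReal_supportK_one hℓ]
  rw [lintegral_const_mul' _ _ hinv_ne, lintegral_sum_kMax hY (fun i ω => abs_nonneg _) hℓN]
  constructor
  · rw [ENNReal.ofReal_one, one_mul, ← one_mul (∫⁻ t in Set.Ioi (0 : ℝ), ENNReal.ofReal _), ← hinv,
      mul_assoc, ← lintegral_const_mul' _ _ (ENNReal.natCast_ne_top ℓ)]
    gcongr with t
    exact mul_measure_exists_le_sum hY hindY (hp t) hfloor hfloorN
  · rw [ENNReal.ofReal_ofNat, ← one_mul (∫⁻ t in Set.Ioi (0 : ℝ), ENNReal.ofReal _), ← hinv,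
      mul_assoc, mul_left_comm, ← lintegral_const_mul' _ _ (ENNReal.natCast_ne_top ℓ),
      ← lintegral_const_mul' _ _ ENNReal.ofNat_ne_top]
    gcongr with t
    exact sum_measure_le_two_mul hY (hp t) measureReal_nonneg measureReal_le_one hceilN
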